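/- **Superiority of repelling random walks for kernel estimation.** Let $\mathcal G$ be a finite undirected simple graph which is (i) a tree or (ii) a two-dimensional rectangular grid ($n_1\times n_2$ nodes, with nodes at distance one in the square lattice adjacent). Let $(a_{uv})$ be a symmetric weighted adjacency matrix of $\mathcal G$ ($a_{uv}\neq 0$ exactly on the edges) with positive weighted degrees $\tilde d_u=\sum_v a_{uv}$, let $\mathbf W=[a_{uv}/(\tilde d_u\tilde d_v)^{1/2}]_{uv}$, and suppose that the entries of $\mathbf W$ on the edges are all equal. Write $d_u$ for the number of neighbours of $u$. Let $i,j$ be nodes at graph distance at least $2$, let $0<p<1$, and let $m$ be an integer with $1\le m\le\min(d_i,d_j)$. From each of $i$ and $j$, independently of each other, simulate an ensemble of $m$ random walks. Every walk steps to uniformly random neighbours and terminates with probability $p$ at each timestep. An ensemble is *i.i.d.* if its walks are independent. It is *transient repelling* if at the first timestep the walkers, divided at random into blocks of size $d$ (the degree of the starting node) and one remainder block, draw their neighbours uniformly without replacement within each block, while after the first timestep the walkers move independently; terminations are independent in both cases. For $\sigma>0$ put $\mathbf U=\frac{\sigma^2}{1+\sigma^2}\mathbf W$. For a walk $\omega=(v_0,\dots,v_n)$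 let $\widetilde\omega(\omega)=\prod_{t<n}\mathbf U_{v_tv_{t+1}}$ and $p(\omega)=\prod_{t<n}\frac{1-p}{d_{v_t}}$. The graph random feature $\phi(i)\in\mathbb R^{\mathcal N}$, where $\mathcal N$ is the set of nodes, has entries $$\phi(i)_x=\frac1m\sum_{k=1}^m\ \sum_{\eta}\frac{\widetilde\omega(\eta)}{p(\eta)},$$ where $\eta$ runs over the prefixes (including the one of length $0$) of the $k$-th walk out of $i$ that end at $x$; $\phi(j)$ is defined in the same way from the walks out of $j$. The estimator of the entry $K_{ij}$ of the 2-regularised Laplacian kernel $\mathbf K=(\mathbf I+\sigma^2(\mathbf I-\mathbf W))^{-2}$ is $\widehat{\mathbf K}_{ij}=(1+\sigma^2)^{-2}\,\phi(i)^\top\phi(j)$. Then there is $\sigma_0>0$ (which may depend on $\mathcal G,a,i,j,p,m$) such that for all $0<\sigma<\sigma_0$ the estimator is square-integrable under both schemes and $$\operatorname{Var}\big([\widehat{\mathbf K}_{ij}]_{\text{repelling}}\big)\le\operatorname{Var}\big([\widehat{\mathbf K}_{ij}]_{\text{i.i.d.}}\big).$$ -/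

import Mathlib

open MeasureTheory ProbabilityTheory Filter Topology

namespace RepellingWalks

noncomputable section

/-- Walks are finite lists of nodes; every set of walks is measurable. -/
instance instMeasurableSpaceList {V : Type*} : MeasurableSpace (List V) := ⊤

section Graphs

variable {V : Type*}

/-- `G` is a two-dimensional (rectangular, square-lattice) grid, with `n₁ * n₂` nodes. -/
def IsGrid2D (G : SimpleGraph V) : Prop :=
  ∃ n₁ n₂ : ℕ, Nonempty (G ≃g (SimpleGraph.pathGraph n₁ □ SimpleGraph.pathGraph n₂))

variable [Fintype V]

/-- The weighted degree of a node: the sum of the entries of its row. -/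
def weightedDegree (a : Matrix V V ℝ) (u : V) : ℝ := ∑ v, a u v

/-- `a` is a weighted adjacency matrix of the undirected graph `G`. The weighted degrees are
positive, so that the normalised adjacency matrix makes sense. -/
structure IsWeightedAdjacency (G : SimpleGraph V) (a : Matrix V V ℝ) : Prop where
  symm : ∀ u v, a u v = a v u
  ne_zero_iff : ∀ u v, a u v ≠ 0 ↔ G.Adj u v
  degree_pos : ∀ u, 0 < weightedDegree a u

/-- The normalised weighted adjacency matrix `W = [a u v / √(d̃ u * d̃ v)]`. -/
def normalizedAdj (a : Matrix V V ℝ) : Matrix V V ℝ :=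
  Matrix.of fun u v => a u v / √(weightedDegree a u * weightedDegree a v)

end Graphs

section Walkers

variable {V : Type*} [Fintype V] [DecidableEq V] (G : SimpleGraph V) [DecidableRel G.Adj]

/-- One step of the simple random walk: a uniformly random neighbour of `v`
(the walker stays put if `v` is isolated). -/
def stepPMF (v : V) : PMF V :=
  if h : (G.neighborFinset v).Nonempty then PMF.uniformOfFinset (G.neighborFinset v) h
  else PMF.pure v

/-- The simple random walk of exactly `n` steps from `v`, as the list of its `n + 1` nodes. -/
def pathPMF : ℕ → V → PMF (List V)
  | 0, v => PMF.pure [v]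
  | n + 1, v => (stepPMF G v).bind fun u => (pathPMF n u).map (List.cons v)

/-- The number of steps taken when terminating with probability `p` at every timestep:
`P(n) = (1 - p) ^ n * p`. -/
def lengthPMF {p : ℝ} (hp0 : 0 < p) (hp1 : p < 1) : PMF ℕ :=
  ⟨fun n => ENNReal.ofReal ((1 - p) ^ n * p), by
    have h := (hasSum_geometric_of_lt_one (sub_nonneg.2 hp1.le) (by linarith)).mul_right p
    rw [sub_sub_cancel, inv_mul_cancel₀ hp0.ne'] at h
    have h0 : ∀ n : ℕ, 0 ≤ (1 - p) ^ n * p := fun n =>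
      mul_nonneg (pow_nonneg (sub_nonneg.2 hp1.le) n) hp0.le
    have h1 : ∑' n : ℕ, ENNReal.ofReal ((1 - p) ^ n * p) = 1 := by
      rw [← ENNReal.ofReal_tsum_of_nonneg h0 h.summable, h.tsum_eq, ENNReal.ofReal_one]
    exact h1 ▸ ENNReal.summable.hasSum⟩

/-- The random walk from `v` that terminates with probability `p` at every timestep: its number
of steps is geometric and independent of the directions taken. -/
def walkPMF {p : ℝ} (hp0 : 0 < p) (hp1 : p < 1) (v : V) : PMF (List V) :=
  (lengthPMF hp0 hp1).bind fun n => pathPMF G n v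

/-- The terminating random walk from `v` whose first hop, if it is taken, leads to `u`. -/
def walkViaPMF {p : ℝ} (hp0 : 0 < p) (hp1 : p < 1) (v u : V) : PMF (List V) :=
  (lengthPMF hp0 hp1).bind fun n =>
    match n with
    | 0 => PMF.pure [v]
    | n + 1 => (pathPMF G n u).map (List.cons v)

/-- The law of `m` independent terminating random walks out of `v`. -/
def iidEnsemble {p : ℝ} (hp0 : 0 < p) (hp1 : p < 1) (m : ℕ) (v : V) :
    Measure (Fin m → List V) :=
  Measure.pi fun _ => (walkPMF G hp0 hp1 v).toMeasure

/-- Pairs `(π, f)` describing a repelling step of `m` walkers at `v`, a node of degree `d`. The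
permutation `π` divides the walkers into blocks `{k | π k / d = b}`, all of size `d` but for a
last remainder block; `f` assigns to each walker a neighbour, without repetition in any block. -/
def repellingAssignments (m : ℕ) (v : V) : Finset (Equiv.Perm (Fin m) × (Fin m → V)) :=
  {x | (∀ k, G.Adj v (x.2 k)) ∧
    ∀ k l, k ≠ l → (x.1 k : ℕ) / G.degree v = (x.1 l : ℕ) / G.degree v → x.2 k ≠ x.2 l}

/-- The law of the new positions of `m` walkers at `v` after one repelling step: a uniformly
random division into blocks, then, in each block, neighbours drawn uniformly without replacement.
Every division admits equally many assignments, so the pair is uniform.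
(The walkers stay put if `v` is isolated.) -/
def repellingStepPMF (m : ℕ) (v : V) : PMF (Fin m → V) :=
  if h : (repellingAssignments G m v).Nonempty then
    (PMF.uniformOfFinset (repellingAssignments G m v) h).map Prod.snd
  else PMF.pure fun _ => v

/-- The law of a transient repelling ensemble of `m` terminating walks out of `v`: the walkers
repel at the first timestep, and given the outcome of that step they are independent. -/
def transientRepellingEnsemble {p : ℝ} (hp0 : 0 < p) (hp1 : p < 1) (m : ℕ) (v : V) :
    Measure (Fin m → List V) :=
  ∑ f : Fin m → V, repellingStepPMF G m v f •
    Measure.pi fun k => (walkViaPMF G hp0 hp1 v (f k)).toMeasure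

end Walkers

section Features

variable {V : Type*} [Fintype V] [DecidableEq V] (G : SimpleGraph V) [DecidableRel G.Adj]

/-- `ω̃(ω)`: the product of the weights of the edges traversed by `ω`. -/
def walkWeight (U : Matrix V V ℝ) : List V → ℝ
  | [] => 1
  | [_] => 1
  | v :: u :: ω => U v u * walkWeight U (u :: ω)

/-- `p(ω)`: the marginal probability that a terminating random walk has the prefix `ω`. -/
def walkProb (p : ℝ) : List V → ℝ
  | [] => 1
  | [_] => 1
  | v :: u :: ω => (1 - p) / G.degree v * walkProb p (u :: ω)

/-- The graph random feature of a node, from the walks `ω 0, …, ω (m - 1)` out of that node and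
the edge weights `U`: every prefix `η` of a walk deposits the load `ω̃(η) / p(η)` at its last
node, and the loads are averaged over the walkers. -/
def graphFeature (U : Matrix V V ℝ) (p : ℝ) {m : ℕ} (ω : Fin m → List V) (x : V) : ℝ :=
  (1 / (m : ℝ)) * ∑ k, ((((ω k).inits.filter fun η => η.getLast? = some x).map
    fun η => walkWeight U η / walkProb G p η).sum)

/-- The graph-random-feature estimator of the entry of the 2-regularised Laplacian kernel
`(I + σ² (I - W))⁻² = (1 + σ²)⁻² (I - σ² / (1 + σ²) W)⁻²` at a pair of nodes, as a function of
the walks out of the first and the second node. -/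
def kernelEstimator (W : Matrix V V ℝ) (p σ : ℝ) {m : ℕ}
    (ω : (Fin m → List V) × (Fin m → List V)) : ℝ :=
  ((1 + σ ^ 2) ^ 2)⁻¹ *
    (graphFeature G ((σ ^ 2 / (1 + σ ^ 2)) • W) p ω.1 ⬝ᵥ
      graphFeature G ((σ ^ 2 / (1 + σ ^ 2)) • W) p ω.2)

end Features

end

end RepellingWalks

/-! Freeze one of the two feature vectors, say `w`. Then `w ⬝ᵥ graphFeature` is a sum over the
walkers of one function `F` of a single walk, so it suffices to compare moments of such additive
statistics.

Given the first hops, the walkers are independent under both schemes, and each hop is marginally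
uniform. The mean is therefore the same, and the second moments differ only through the correlation
of the conditional means of `F` given the first hops. As `m` is at most the degree, there is one
block, sampled without replacement, which makes these correlations nonpositive
(`sum_repellingAssignments_mul_nonpos`, `integral_sq_sum_transientRepellingEnsemble_le`).

The two ensembles are independent, so Fubini allows repulsion to be introduced at one node at a
time: the mean of the estimator is unchanged and its second moment does not grow. Small `σ` serves
to make loads decay geometrically along a walk, so that every statistic is bounded. -/

namespace RepellingWalks

/-! ### Sampling neighbours without replacement -/

section Sampling

/-- If `g` maps `I` to `S` with equally large fibres, then averages of `c ∘ g` over `I` are averages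
of `c` over `S`. -/
theorem card_mul_sum_comp_of_card_fiber_eq {α V : Type*} [DecidableEq V] {I : Finset α}
    {g : α → V} {S : Finset V} (hg : ∀ x ∈ I, g x ∈ S)
    (h : ∀ u ∈ S, ∀ w ∈ S, (I.filter fun x => g x = u).card = (I.filter fun x => g x = w).card)
    (c : V → ℝ) : (S.card : ℝ) * ∑ x ∈ I, c (g x) = I.card * ∑ u ∈ S, c u := by
  rcases S.eq_empty_or_nonempty with rfl | ⟨w, hw⟩
  · simp
  have h1 : ∑ x ∈ I, c (g x) = ∑ u ∈ S, (I.filter fun x => g x = w).card * c u := by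
    rw [← Finset.sum_fiberwise_of_maps_to hg]
    refine Finset.sum_congr rfl fun u hu => ?_
    rw [Finset.sum_congr rfl (g := fun _ => c u) fun x hx => by rw [(Finset.mem_filter.1 hx).2],
      Finset.sum_const, nsmul_eq_mul, h u hu w hw]
  have h2 : I.card = S.card * (I.filter fun x => g x = w).card := by
    rw [Finset.card_eq_sum_card_fiberwise hg, Finset.sum_congr rfl fun u hu => h u hu w hw,
      Finset.sum_const, smul_eq_mul]
  rw [h1, h2, ← Finset.mul_sum]
  push_cast
  ring

variable {V : Type*} [Fintype V] [DecidableEq V] {G : SimpleGraph V} [DecidableRel G.Adj]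
  {m : ℕ} {v : V}

/-- With at most `G.degree v` walkers there is a single block. -/
theorem mem_repellingAssignments (hm : m ≤ G.degree v)
    {x : Equiv.Perm (Fin m) × (Fin m → V)} :
    x ∈ repellingAssignments G m v ↔ (∀ k, G.Adj v (x.2 k)) ∧ Function.Injective x.2 := by
  have h0 (k : Fin m) : (x.1 k : ℕ) / G.degree v = 0 := Nat.div_eq_of_lt ((x.1 k).2.trans_le hm)
  simp only [repellingAssignments, Finset.mem_filter, Finset.mem_univ, true_and, h0,
    forall_const]
  refine and_congr_right fun _ => ⟨fun h k l hkl => ?_, fun h k l hkl h' => hkl (h h')⟩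
  by_contra hne
  exact h k l hne hkl

theorem repellingAssignments_nonempty (hm : m ≤ G.degree v) :
    (repellingAssignments G m v).Nonempty := by
  let e := (G.neighborFinset v).equivFin.symm
  refine ⟨(1, fun k => (e ⟨k, k.2.trans_le hm⟩ : V)),
    (mem_repellingAssignments hm).2 ⟨fun k => ?_, fun k l hkl => ?_⟩⟩
  · exact (G.mem_neighborFinset v _).1 (e ⟨k, k.2.trans_le hm⟩).2
  · simpa [Fin.ext_iff] using e.injective (Subtype.ext hkl)

/-- Composing with the transposition of `u` and `w` is an involution of the injective assignments
that exchanges the two fibres. A trivial `P` gives the law of one walker; `P` fixing another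
walker's position gives the conditional law. -/
theorem card_repellingAssignments_filter_swap (hm : m ≤ G.degree v) {u w : V} (hu : G.Adj v u)
    (hw : G.Adj v w) (k : Fin m) (P : (Fin m → V) → Prop) [DecidablePred P]
    (hP : ∀ f, P f → P (Equiv.swap u w ∘ f)) :
    (((repellingAssignments G m v).filter fun x => P x.2).filter fun x => x.2 k = u).card =
      (((repellingAssignments G m v).filter fun x => P x.2).filter fun x => x.2 k = w).card := by
  let s : Equiv.Perm (Fin m) × (Fin m → V) → Equiv.Perm (Fin m) × (Fin m → V) :=
    fun x => (x.1, Equiv.swap u w ∘ x.2)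
  have hs (x) : s (s x) = x := by
    ext <;> simp [s]
  have hI (x) (hx : x ∈ (repellingAssignments G m v).filter fun x => P x.2) :
      s x ∈ (repellingAssignments G m v).filter fun x => P x.2 := by
    rw [Finset.mem_filter, mem_repellingAssignments hm] at hx ⊢
    refine ⟨⟨fun k => ?_, (Equiv.injective _).comp hx.1.2⟩, hP _ hx.2⟩
    change G.Adj v (Equiv.swap u w (x.2 k))
    rw [Equiv.swap_apply_def]
    split_ifs
    exacts [hw, hu, hx.1.1 k]
  refine Finset.card_nbij' s s ?_ ?_ (fun x _ => hs x) fun x _ => hs x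
  · intro x hx
    simp only [Finset.mem_coe, Finset.mem_filter (p := fun x : _ × (Fin m → V) => x.2 k = _)] at hx ⊢
    exact ⟨hI x hx.1, by simp [s, hx.2]⟩
  · intro x hx
    simp only [Finset.mem_coe, Finset.mem_filter (p := fun x : _ × (Fin m → V) => x.2 k = _)] at hx ⊢
    exact ⟨hI x hx.1, by simp [s, hx.2]⟩

/-- Each walker is sent to a uniformly random neighbour. -/
theorem degree_mul_sum_repellingAssignments (hm : m ≤ G.degree v) (k : Fin m) (c : V → ℝ) :
    (G.degree v : ℝ) * ∑ x ∈ repellingAssignments G m v, c (x.2 k) =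
      (repellingAssignments G m v).card * ∑ u ∈ G.neighborFinset v, c u := by
  refine card_mul_sum_comp_of_card_fiber_eq (S := G.neighborFinset v) (fun x hx => ?_)
    (fun u hu w hw => ?_) c
  · exact (G.mem_neighborFinset v _).2 (((mem_repellingAssignments hm).1 hx).1 k)
  · rw [SimpleGraph.mem_neighborFinset] at hu hw
    simpa using card_repellingAssignments_filter_swap hm hu hw k (fun _ => True) (fun _ h => h)

/-- The positions of two repelling walkers are negatively correlated. -/
theorem sum_repellingAssignments_mul_nonpos (hm : m ≤ G.degree v) {k l : Fin m} (hkl : k ≠ l)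
    {c : V → ℝ} (hc : ∑ u ∈ G.neighborFinset v, c u = 0) :
    ∑ x ∈ repellingAssignments G m v, c (x.2 k) * c (x.2 l) ≤ 0 := by
  set I := repellingAssignments G m v with hI
  set N := G.neighborFinset v with hN
  have hadj {x} (hx : x ∈ I) (k : Fin m) : x.2 k ∈ N :=
    (G.mem_neighborFinset v _).2 (((mem_repellingAssignments hm).1 hx).1 k)
  rw [← Finset.sum_fiberwise_of_maps_to (fun x hx => hadj hx k)]
  refine Finset.sum_nonpos fun u hu => ?_
  rw [Finset.sum_congr rfl (g := fun x => c u * c (x.2 l))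
    fun x hx => by rw [(Finset.mem_filter.1 hx).2], ← Finset.mul_sum]
  -- Given that walker `k` sits at `u`, walker `l` is uniform on the other neighbours, where `c`
  -- sums to `-c u`. The fibre thus contributes a nonpositive multiple of `c u ^ 2`.
  have key := card_mul_sum_comp_of_card_fiber_eq (I := I.filter fun x => x.2 k = u)
    (g := fun x => x.2 l) (S := N.erase u)
    (fun x hx => by
      rw [Finset.mem_filter] at hx
      refine Finset.mem_erase.2 ⟨fun h => hkl ?_, hadj hx.1 l⟩
      exact ((mem_repellingAssignments hm).1 hx.1).2 (hx.2.trans h.symm))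
    (fun w hw w' hw' => by
      rw [Finset.mem_erase, SimpleGraph.mem_neighborFinset] at hw hw'
      refine card_repellingAssignments_filter_swap hm hw.2 hw'.2 l (fun f => f k = u) ?_
      intro f hf
      simp only [Function.comp_apply, hf]
      exact Equiv.swap_apply_of_ne_of_ne hw.1.symm hw'.1.symm) c
  have hsum : ∑ w ∈ N.erase u, c w = - c u := by
    linarith [Finset.add_sum_erase N c hu]
  have hcard : (0 : ℝ) < (N.erase u).card := by
    rw [Nat.cast_pos, Finset.card_erase_of_mem hu]
    have : Fintype.card (Fin m) ≤ N.card := by simpa [hN] using hm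
    have : 1 < Fintype.card (Fin m) := Fintype.one_lt_card_iff.2 ⟨k, l, hkl⟩
    omega
  rw [hsum] at key
  refine nonpos_of_mul_nonpos_right ?_ hcard
  rw [mul_left_comm, key]
  nlinarith [mul_nonneg (Nat.cast_nonneg (α := ℝ) (I.filter fun x => x.2 k = u).card)
    (sq_nonneg (c u))]

theorem sum_repellingAssignments_sq_le (hm : m ≤ G.degree v) {c : V → ℝ}
    (hc : ∑ u ∈ G.neighborFinset v, c u = 0) :
    ∑ x ∈ repellingAssignments G m v, (∑ k, c (x.2 k)) ^ 2 ≤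
      ∑ x ∈ repellingAssignments G m v, ∑ k, c (x.2 k) ^ 2 := by
  have h (x : Equiv.Perm (Fin m) × (Fin m → V)) : (∑ k, c (x.2 k)) ^ 2 = ∑ k, c (x.2 k) ^ 2 +
      ∑ k, ∑ l ∈ Finset.univ.erase k, c (x.2 k) * c (x.2 l) := by
    rw [sq, Finset.sum_mul_sum, ← Finset.sum_add_distrib]
    refine Finset.sum_congr rfl fun k _ => ?_
    rw [← Finset.add_sum_erase _ _ (Finset.mem_univ k), sq]
  simp only [h, Finset.sum_add_distrib, add_le_iff_nonpos_right]
  rw [Finset.sum_comm]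
  refine Finset.sum_nonpos fun k _ => ?_
  rw [Finset.sum_comm]
  exact Finset.sum_nonpos fun l hl =>
    sum_repellingAssignments_mul_nonpos hm (Finset.ne_of_mem_erase hl).symm hc

end Sampling
-- Moments of additive statistics of an ensemble
section Moments

/-- Lists over a finite `V` are countable, so finite products of walk spaces are still discrete and
boundedness alone gives integrability. -/
theorem integrable_of_abs_le {Ω : Type*} [MeasurableSpace Ω] [DiscreteMeasurableSpace Ω]
    (μ : Measure Ω) [IsFiniteMeasure μ] {H : Ω → ℝ} {C : ℝ} (hH : ∀ ω, |H ω| ≤ C) :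
    Integrable H μ :=
  .of_bound (Measurable.of_discrete.aestronglyMeasurable) C (ae_of_all _ hH)

theorem memLp_of_abs_le {Ω : Type*} [MeasurableSpace Ω] [DiscreteMeasurableSpace Ω]
    (μ : Measure Ω) [IsFiniteMeasure μ] {H : Ω → ℝ} {C : ℝ} (hH : ∀ ω, |H ω| ≤ C) :
    MemLp H 2 μ :=
  .of_bound (Measurable.of_discrete.aestronglyMeasurable) C (ae_of_all _ hH)

theorem integral_sum_comp_eval {ι Ω : Type*} [Fintype ι] [MeasurableSpace Ω] (μ : ι → Measure Ω)
    [∀ k, IsProbabilityMeasure (μ k)] {F : Ω → ℝ} (hF : ∀ k, MemLp F 2 (μ k)) :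
    ∫ ω, ∑ k, F (ω k) ∂Measure.pi μ = ∑ k, ∫ x, F x ∂μ k := by
  have hF1 k : Integrable F (μ k) := (hF k).integrable one_le_two
  rw [integral_finsetSum]
  · exact Finset.sum_congr rfl fun k _ => integral_comp_eval (hF1 k).aestronglyMeasurable
  · exact fun k _ => (measurePreserving_eval μ k).integrable_comp_of_integrable (hF1 k)

theorem integral_sq_sum_comp_eval {ι Ω : Type*} [Fintype ι] [MeasurableSpace Ω]
    (μ : ι → Measure Ω) [∀ k, IsProbabilityMeasure (μ k)] {F : Ω → ℝ}
    (hF : ∀ k, MemLp F 2 (μ k)) :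
    ∫ ω, (∑ k, F (ω k)) ^ 2 ∂Measure.pi μ =
      ∑ k, ((∫ x, F x ^ 2 ∂μ k) - (∫ x, F x ∂μ k) ^ 2) + (∑ k, ∫ x, F x ∂μ k) ^ 2 := by
  have h1 := variance_sum_pi (X := fun _ => F) hF
  have h2 : MemLp (∑ k, fun ω : ι → Ω => F (ω k)) 2 (Measure.pi μ) :=
    memLp_finsetSum' _ fun k _ => (hF k).comp_measurePreserving (measurePreserving_eval μ k)
  rw [variance_eq_sub h2] at h1
  simp only [variance_eq_sub (hF _), Pi.pow_apply, Finset.sum_apply,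
    integral_sum_comp_eval μ hF] at h1
  linarith

variable {V : Type*} [Fintype V] [DecidableEq V] {G : SimpleGraph V} [DecidableRel G.Adj]
  {p : ℝ} (hp0 : 0 < p) (hp1 : p < 1) {m : ℕ} {v : V}

-- Length and directions are independent, so the first hop may be drawn before the length; a walk of
-- length zero ignores it.
omit [DecidableEq V] in
theorem walkPMF_eq_bind : walkPMF G hp0 hp1 v = (stepPMF G v).bind (walkViaPMF G hp0 hp1 v) := by
  rw [walkPMF]
  unfold walkViaPMF
  rw [PMF.bind_comm]
  congr 1
  funext n
  cases n with
  | zero => simp [pathPMF]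
  | succ n => rfl

omit [DecidableEq V] in
theorem integral_walkPMF (hv : 0 < G.degree v) {F : List V → ℝ} {C : ℝ} (hF : ∀ l, |F l| ≤ C) :
    ∫ l, F l ∂(walkPMF G hp0 hp1 v).toMeasure =
      (G.degree v : ℝ)⁻¹ * ∑ u ∈ G.neighborFinset v,
        ∫ l, F l ∂(walkViaPMF G hp0 hp1 v u).toMeasure := by
  have hN : (G.neighborFinset v).Nonempty := by
    rwa [← Finset.card_pos, SimpleGraph.card_neighborFinset_eq_degree]
  have h : (walkPMF G hp0 hp1 v).toMeasure = ∑ u ∈ G.neighborFinset v,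
      (G.degree v : ENNReal)⁻¹ • (walkViaPMF G hp0 hp1 v u).toMeasure := by
    ext s hs
    rw [walkPMF_eq_bind, PMF.toMeasure_bind_apply _ _ _ hs, tsum_fintype, stepPMF, dif_pos hN]
    simp [PMF.uniformOfFinset_apply, Finset.sum_ite, ite_mul]
    rw [SimpleGraph.neighborFinset_eq_filter]
  rw [h, integral_finsetSum_measure, Finset.mul_sum]
  · simp [integral_smul_measure]
  · exact fun u _ => (integrable_of_abs_le _ hF).smul_measure (by simp [hv.ne'])

instance instIsProbabilityMeasureIidEnsemble :
    IsProbabilityMeasure (iidEnsemble G hp0 hp1 m v) := by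
  unfold iidEnsemble
  infer_instance

instance instIsProbabilityMeasureTransientRepellingEnsemble :
    IsProbabilityMeasure (transientRepellingEnsemble G hp0 hp1 m v) := by
  constructor
  have h := (repellingStepPMF G m v).tsum_coe
  rw [tsum_fintype] at h
  simp [transientRepellingEnsemble, h]

theorem sum_repellingStepPMF_mul (hm : m ≤ G.degree v) (H : (Fin m → V) → ℝ) :
    ∑ f, (repellingStepPMF G m v f).toReal * H f =
      ((repellingAssignments G m v).card : ℝ)⁻¹ * ∑ x ∈ repellingAssignments G m v, H x.2 := by
  have h (f : Fin m → V) : (repellingStepPMF G m v f).toReal =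
      ∑ x ∈ repellingAssignments G m v,
        if f = x.2 then ((repellingAssignments G m v).card : ℝ)⁻¹ else 0 := by
    rw [repellingStepPMF, dif_pos (repellingAssignments_nonempty hm), PMF.map_apply, tsum_fintype,
      ENNReal.toReal_sum, ← Finset.sum_subset (Finset.subset_univ (repellingAssignments G m v))]
    · refine Finset.sum_congr rfl fun x hx => ?_
      split_ifs <;> simp [PMF.uniformOfFinset_apply, hx]
    · intro x _ hx
      simp [PMF.uniformOfFinset_apply, hx]
    · intro x _
      split_ifs
      exacts [PMF.apply_ne_top _ _, ENNReal.zero_ne_top]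
  simp_rw [h, Finset.sum_mul]
  rw [Finset.sum_comm, Finset.mul_sum]
  simp [ite_mul]

theorem integral_transientRepellingEnsemble (hm : m ≤ G.degree v) {H : (Fin m → List V) → ℝ}
    {C : ℝ} (hH : ∀ ω, |H ω| ≤ C) :
    ∫ ω, H ω ∂transientRepellingEnsemble G hp0 hp1 m v =
      ((repellingAssignments G m v).card : ℝ)⁻¹ * ∑ x ∈ repellingAssignments G m v,
        ∫ ω, H ω ∂Measure.pi fun k => (walkViaPMF G hp0 hp1 v (x.2 k)).toMeasure := by
  rw [← sum_repellingStepPMF_mul hm fun f =>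
    ∫ ω, H ω ∂Measure.pi fun k => (walkViaPMF G hp0 hp1 v (f k)).toMeasure,
    transientRepellingEnsemble, integral_finsetSum_measure]
  · simp only [integral_smul_measure, smul_eq_mul]
  · exact fun f _ => (integrable_of_abs_le _ hH).smul_measure (PMF.apply_ne_top _ _)

theorem inv_card_mul_sum_repellingAssignments (hm0 : 0 < m) (hm : m ≤ G.degree v) (k : Fin m)
    (c : V → ℝ) :
    ((repellingAssignments G m v).card : ℝ)⁻¹ * ∑ x ∈ repellingAssignments G m v, c (x.2 k) =
      (G.degree v : ℝ)⁻¹ * ∑ u ∈ G.neighborFinset v, c u := by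
  have h1 : ((repellingAssignments G m v).card : ℝ) ≠ 0 := by
    simpa using (repellingAssignments_nonempty hm).ne_empty
  have h2 : (G.degree v : ℝ) ≠ 0 := by exact_mod_cast (hm0.trans_le hm).ne'
  have h3 := degree_mul_sum_repellingAssignments hm k c
  field_simp
  linarith

omit [Fintype V] [DecidableEq V] in
theorem abs_sum_comp_le {F : List V → ℝ} {C : ℝ} (hF : ∀ l, |F l| ≤ C) (ω : Fin m → List V) :
    |∑ k, F (ω k)| ≤ m * C := by
  refine (Finset.abs_sum_le_sum_abs _ _).trans ?_
  simpa using Finset.sum_le_sum fun k (_ : k ∈ Finset.univ) => hF (ω k)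

/-- Repulsion does not change the mean of an additive statistic of the ensemble. -/
theorem integral_sum_transientRepellingEnsemble (hm0 : 0 < m) (hm : m ≤ G.degree v)
    {F : List V → ℝ} {C : ℝ} (hF : ∀ l, |F l| ≤ C) :
    ∫ ω, ∑ k, F (ω k) ∂transientRepellingEnsemble G hp0 hp1 m v =
      ∫ ω, ∑ k, F (ω k) ∂iidEnsemble G hp0 hp1 m v := by
  rw [integral_transientRepellingEnsemble hp0 hp1 hm (abs_sum_comp_le hF), iidEnsemble,
    integral_sum_comp_eval _ fun _ => memLp_of_abs_le _ hF]
  simp_rw [integral_sum_comp_eval _ fun _ => memLp_of_abs_le _ hF,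
    integral_walkPMF hp0 hp1 (hm0.trans_le hm) hF]
  rw [Finset.sum_comm, Finset.mul_sum]
  exact Finset.sum_congr rfl fun k _ => inv_card_mul_sum_repellingAssignments hm0 hm k
    fun u => ∫ l, F l ∂(walkViaPMF G hp0 hp1 v u).toMeasure

/-- Repulsion does not increase the second moment of an additive statistic of the ensemble. -/
theorem integral_sq_sum_transientRepellingEnsemble_le (hm0 : 0 < m) (hm : m ≤ G.degree v)
    {F : List V → ℝ} {C : ℝ} (hF : ∀ l, |F l| ≤ C) :
    ∫ ω, (∑ k, F (ω k)) ^ 2 ∂transientRepellingEnsemble G hp0 hp1 m v ≤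
      ∫ ω, (∑ k, F (ω k)) ^ 2 ∂iidEnsemble G hp0 hp1 m v := by
  have hF2 (l) : |F l ^ 2| ≤ C ^ 2 := by
    rw [abs_pow]
    exact pow_le_pow_left₀ (abs_nonneg _) (hF l) 2
  have hS (ω : Fin m → List V) : |(∑ k, F (ω k)) ^ 2| ≤ (m * C) ^ 2 := by
    rw [abs_pow]
    exact pow_le_pow_left₀ (abs_nonneg _) (abs_sum_comp_le hF ω) 2
  have hd := hm0.trans_le hm
  rw [integral_transientRepellingEnsemble hp0 hp1 hm hS, iidEnsemble,
    integral_sq_sum_comp_eval _ fun _ => memLp_of_abs_le _ hF]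
  simp_rw [integral_sq_sum_comp_eval _ fun _ => memLp_of_abs_le _ hF,
    integral_walkPMF hp0 hp1 hd hF, integral_walkPMF hp0 hp1 hd hF2]
  -- `e` and `s` are the conditional first and second moments of `F` given the first hop; `E` and
  -- `S` are their averages over the neighbours.
  set e : V → ℝ := fun u => ∫ l, F l ∂(walkViaPMF G hp0 hp1 v u).toMeasure
  set s : V → ℝ := fun u => ∫ l, F l ^ 2 ∂(walkViaPMF G hp0 hp1 v u).toMeasure
  set I := repellingAssignments G m v
  set E : ℝ := (G.degree v : ℝ)⁻¹ * ∑ u ∈ G.neighborFinset v, e u with hE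
  set S : ℝ := (G.degree v : ℝ)⁻¹ * ∑ u ∈ G.neighborFinset v, s u
  have hI : (0 : ℝ) < I.card := by exact_mod_cast (repellingAssignments_nonempty hm).card_pos
  have hd' : (G.degree v : ℝ) ≠ 0 := by exact_mod_cast hd.ne'
  have hc : ∑ u ∈ G.neighborFinset v, (e u - E) = 0 := by
    rw [Finset.sum_sub_distrib, Finset.sum_const, SimpleGraph.card_neighborFinset_eq_degree, hE,
      nsmul_eq_mul, mul_inv_cancel_left₀ hd', sub_self]
  have key := sum_repellingAssignments_sq_le hm hc
  have hs k : ∑ x ∈ I, s (x.2 k) = I.card * S :=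
    (inv_mul_eq_iff_eq_mul₀ hI.ne').1 (inv_card_mul_sum_repellingAssignments hm0 hm k s)
  have he k : ∑ x ∈ I, e (x.2 k) = I.card * E :=
    (inv_mul_eq_iff_eq_mul₀ hI.ne').1 (inv_card_mul_sum_repellingAssignments hm0 hm k e)
  have hs' : ∑ x ∈ I, ∑ k, s (x.2 k) = m * (I.card * S) := by
    rw [Finset.sum_comm, Finset.sum_congr rfl fun k _ => hs k]; simp
  have he' : ∑ x ∈ I, ∑ k, e (x.2 k) = m * (I.card * E) := by
    rw [Finset.sum_comm, Finset.sum_congr rfl fun k _ => he k]; simp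
  -- Centring `e` at `E` isolates the off-diagonal products, whose average is nonpositive by `key`.
  -- The rest is affine in the sums of `s` and `e`, so uniform marginals determine its average: the
  -- i.i.d. value `m * (S - E ^ 2) + (m * E) ^ 2`.
  have expand (x : Equiv.Perm (Fin m) × (Fin m → V)) :
      ∑ k, (s (x.2 k) - e (x.2 k) ^ 2) + (∑ k, e (x.2 k)) ^ 2 =
        ((∑ k, (e (x.2 k) - E)) ^ 2 - ∑ k, (e (x.2 k) - E) ^ 2) + ∑ k, s (x.2 k)
          + (2 * m * E - 2 * E) * ∑ k, e (x.2 k) + (m * E ^ 2 - m ^ 2 * E ^ 2) := by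
    simp only [sub_sq, Finset.sum_sub_distrib, Finset.sum_add_distrib, ← Finset.sum_mul,
      ← Finset.mul_sum, Finset.sum_const, Finset.card_univ, Fintype.card_fin, nsmul_eq_mul]
    ring
  rw [inv_mul_le_iff₀ hI, Finset.sum_congr rfl fun x _ => expand x]
  simp only [Finset.sum_add_distrib, Finset.sum_sub_distrib, ← Finset.mul_sum, hs', he',
    Finset.sum_const, Finset.card_univ, Fintype.card_fin, nsmul_eq_mul] at key ⊢
  linarith

end Moments
-- Bounds and linearity of graph random features
section Features

variable {V : Type*} [Fintype V] [DecidableEq V] {G : SimpleGraph V} [DecidableRel G.Adj]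
  {U : Matrix V V ℝ} {p : ℝ} {m : ℕ}

-- The empty prefix contributes 1. Each further hop multiplies the load by at most 1/2 in absolute
-- value, so the nonempty prefixes contribute at most 1 + 1/2 + 1/4 + ... = 2.
omit [DecidableEq V] in
theorem sum_inits_abs_le (hU : ∀ u v, |U u v / ((1 - p) / G.degree u)| ≤ 1 / 2) (l : List V) :
    (l.inits.map fun η => |walkWeight U η / walkProb G p η|).sum ≤ 3 := by
  induction l with
  | nil => norm_num [walkWeight, walkProb]
  | cons v l ih =>
    cases l with
    | nil => norm_num [walkWeight, walkProb]
    | cons u l =>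
      have h : (l.inits.map fun η => |walkWeight U (v :: u :: η) / walkProb G p (v :: u :: η)|).sum
          ≤ 1 / 2 * (l.inits.map fun η =>
            |walkWeight U (u :: η) / walkProb G p (u :: η)|).sum := by
        rw [← List.sum_map_mul_left]
        refine List.sum_le_sum fun η _ => ?_
        rw [walkWeight, walkProb, mul_div_mul_comm, abs_mul]
        exact mul_le_mul_of_nonneg_right (hU v u) (abs_nonneg _)
      simp only [List.inits_cons, List.map_cons, List.map_map, List.sum_cons, Function.comp_def,
        walkWeight, walkProb, div_one, abs_one] at ih h ⊢
      linarith

variable (G U p) in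
/-- The load which the prefixes of a walk deposit at the node `x`. -/
noncomputable def walkLoad (l : List V) (x : V) : ℝ :=
  ((l.inits.filter fun η => η.getLast? = some x).map
    fun η => walkWeight U η / walkProb G p η).sum

theorem abs_walkLoad_le (hU : ∀ u v, |U u v / ((1 - p) / G.degree u)| ≤ 1 / 2) (l : List V)
    (x : V) : |walkLoad G U p l x| ≤ 3 := by
  refine le_trans ?_ (sum_inits_abs_le hU l)
  have h (L : List (List V)) (q : List V → Bool) (f : List V → ℝ) :
      |((L.filter q).map f).sum| ≤ (L.map fun η => |f η|).sum := by
    induction L with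
    | nil => simp
    | cons η L ih =>
      rw [List.filter_cons]
      split_ifs
      · simpa using (abs_add_le _ _).trans (by gcongr)
      · simpa using ih.trans (le_add_of_nonneg_left (abs_nonneg _))
  exact h _ _ _

/-- Brings a projection of the feature into the form `∑ k, F (ω k)` required by the moment
comparison. -/
theorem dotProduct_graphFeature (w : V → ℝ) (ω : Fin m → List V) :
    w ⬝ᵥ graphFeature G U p ω =
      ∑ k, (1 / (m : ℝ)) * ∑ x, w x * walkLoad G U p (ω k) x := by
  simp only [dotProduct, graphFeature, walkLoad, Finset.mul_sum]
  rw [Finset.sum_comm]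
  refine Finset.sum_congr rfl fun k _ => Finset.sum_congr rfl fun x _ => by ring

theorem abs_sum_mul_walkLoad_le (hU : ∀ u v, |U u v / ((1 - p) / G.degree u)| ≤ 1 / 2)
    (w : V → ℝ) (l : List V) :
    |(1 / (m : ℝ)) * ∑ x, w x * walkLoad G U p l x| ≤ (1 / (m : ℝ)) * ∑ x, |w x| * 3 := by
  rw [abs_mul, abs_of_nonneg (by positivity : 0 ≤ 1 / (m : ℝ))]
  gcongr
  refine (Finset.abs_sum_le_sum_abs _ _).trans (Finset.sum_le_sum fun x _ => ?_)
  rw [abs_mul]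
  exact mul_le_mul_of_nonneg_left (abs_walkLoad_le hU l x) (abs_nonneg _)

theorem abs_graphFeature_le (hU : ∀ u v, |U u v / ((1 - p) / G.degree u)| ≤ 1 / 2)
    (ω : Fin m → List V) (x : V) : |graphFeature G U p ω x| ≤ 3 := by
  change |(1 / (m : ℝ)) * ∑ k, walkLoad G U p (ω k) x| ≤ 3
  have h := abs_sum_comp_le (F := fun l => walkLoad G U p l x)
    (fun l => abs_walkLoad_le hU l x) ω
  rcases m.eq_zero_or_pos with rfl | hm
  · simp
  rw [abs_mul, abs_of_nonneg (by positivity : 0 ≤ 1 / (m : ℝ)), one_div,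
    inv_mul_le_iff₀ (by exact_mod_cast hm)]
  exact h

theorem abs_dotProduct_graphFeature_le (hU : ∀ u v, |U u v / ((1 - p) / G.degree u)| ≤ 1 / 2)
    (ω₁ ω₂ : Fin m → List V) :
    |graphFeature G U p ω₁ ⬝ᵥ graphFeature G U p ω₂| ≤ Fintype.card V * 9 := by
  refine (Finset.abs_sum_le_sum_abs _ _).trans ?_
  have h : ∑ x, |graphFeature G U p ω₁ x * graphFeature G U p ω₂ x| ≤ ∑ _x : V, (9 : ℝ) := by
    refine Finset.sum_le_sum fun x _ => ?_
    rw [abs_mul]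
    nlinarith [abs_graphFeature_le hU ω₁ x, abs_graphFeature_le hU ω₂ x,
      abs_nonneg (graphFeature G U p ω₁ x), abs_nonneg (graphFeature G U p ω₂ x)]
  simpa using h

/-! ### Comparison of the schemes for a pair of ensembles -/

variable (hp0 : 0 < p) (hp1 : p < 1) {i j v : V}

theorem integral_dotProduct_transientRepellingEnsemble
    (hU : ∀ u v, |U u v / ((1 - p) / G.degree u)| ≤ 1 / 2)
    (hm0 : 0 < m) (hm : m ≤ G.degree v) (w : V → ℝ) :
    ∫ ω, w ⬝ᵥ graphFeature G U p ω ∂transientRepellingEnsemble G hp0 hp1 m v =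
      ∫ ω, w ⬝ᵥ graphFeature G U p ω ∂iidEnsemble G hp0 hp1 m v := by
  simp_rw [dotProduct_graphFeature]
  exact integral_sum_transientRepellingEnsemble hp0 hp1 hm0 hm (abs_sum_mul_walkLoad_le hU w)

theorem integral_sq_dotProduct_transientRepellingEnsemble_le
    (hU : ∀ u v, |U u v / ((1 - p) / G.degree u)| ≤ 1 / 2)
    (hm0 : 0 < m) (hm : m ≤ G.degree v) (w : V → ℝ) :
    ∫ ω, (w ⬝ᵥ graphFeature G U p ω) ^ 2 ∂transientRepellingEnsemble G hp0 hp1 m v ≤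
      ∫ ω, (w ⬝ᵥ graphFeature G U p ω) ^ 2 ∂iidEnsemble G hp0 hp1 m v := by
  simp_rw [dotProduct_graphFeature]
  exact integral_sq_sum_transientRepellingEnsemble_le hp0 hp1 hm0 hm
    (abs_sum_mul_walkLoad_le hU w)

/-- If bounded statistics of one ensemble are compared for every outcome of the other ensemble,
then they are comparable for the pair of ensembles. -/
theorem integral_prod_le_integral_prod_of_forall {Ω : Type*} [MeasurableSpace Ω]
    [DiscreteMeasurableSpace (Ω × Ω)] {μ μ' ν ν' : Measure Ω} [IsFiniteMeasure μ]
    [IsFiniteMeasure μ'] [IsFiniteMeasure ν] [IsFiniteMeasure ν'] {H : Ω × Ω → ℝ} {C : ℝ}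
    (hH : ∀ ω, |H ω| ≤ C) (h₁ : ∀ y, ∫ x, H (x, y) ∂μ ≤ ∫ x, H (x, y) ∂μ')
    (h₂ : ∀ x, ∫ y, H (x, y) ∂ν ≤ ∫ y, H (x, y) ∂ν') :
    ∫ ω, H ω ∂μ.prod ν ≤ ∫ ω, H ω ∂μ'.prod ν' := by
  have hi (μ ν : Measure Ω) [IsFiniteMeasure μ] [IsFiniteMeasure ν] :
      Integrable H (μ.prod ν) := integrable_of_abs_le _ hH
  -- The intermediate law is the hybrid `μ'.prod ν`, reached by changing only the first factor.
  calc ∫ ω, H ω ∂μ.prod ν = ∫ y, ∫ x, H (x, y) ∂μ ∂ν := integral_prod_symm _ (hi μ ν)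
    _ ≤ ∫ y, ∫ x, H (x, y) ∂μ' ∂ν :=
      integral_mono (hi μ ν).integral_prod_right (hi μ' ν).integral_prod_right h₁
    _ = ∫ x, ∫ y, H (x, y) ∂ν ∂μ' := by
      rw [← integral_prod_symm _ (hi μ' ν), integral_prod _ (hi μ' ν)]
    _ ≤ ∫ x, ∫ y, H (x, y) ∂ν' ∂μ' :=
      integral_mono (hi μ' ν).integral_prod_left (hi μ' ν').integral_prod_left h₂
    _ = ∫ ω, H ω ∂μ'.prod ν' := (integral_prod _ (hi μ' ν')).symm

theorem variance_dotProduct_graphFeature_le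
    (hU : ∀ u v, |U u v / ((1 - p) / G.degree u)| ≤ 1 / 2)
    (hm0 : 0 < m) (hmi : m ≤ G.degree i) (hmj : m ≤ G.degree j) :
    variance (fun ω => graphFeature G U p ω.1 ⬝ᵥ graphFeature G U p ω.2)
        ((transientRepellingEnsemble G hp0 hp1 m i).prod
          (transientRepellingEnsemble G hp0 hp1 m j)) ≤
      variance (fun ω => graphFeature G U p ω.1 ⬝ᵥ graphFeature G U p ω.2)
        ((iidEnsemble G hp0 hp1 m i).prod (iidEnsemble G hp0 hp1 m j)) := by
  have hb (ω : (Fin m → List V) × (Fin m → List V)) := abs_dotProduct_graphFeature_le hU ω.1 ω.2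
  have hb2 (ω : (Fin m → List V) × (Fin m → List V)) :
      |(graphFeature G U p ω.1 ⬝ᵥ graphFeature G U p ω.2) ^ 2| ≤ (Fintype.card V * 9) ^ 2 := by
    rw [abs_pow]
    exact pow_le_pow_left₀ (abs_nonneg _) (hb ω) 2
  have hmean {v : V} (hm : m ≤ G.degree v) :=
    integral_dotProduct_transientRepellingEnsemble hp0 hp1 hU hm0 hm
  have hsq {v : V} (hm : m ≤ G.degree v) :=
    integral_sq_dotProduct_transientRepellingEnsemble_le hp0 hp1 hU hm0 hm
  rw [variance_eq_sub (memLp_of_abs_le _ hb), variance_eq_sub (memLp_of_abs_le _ hb)]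
  refine sub_le_sub ?_ (le_of_eq ?_)
  · refine integral_prod_le_integral_prod_of_forall
      (H := fun ω => (graphFeature G U p ω.1 ⬝ᵥ graphFeature G U p ω.2) ^ 2) hb2 (fun y => ?_)
      fun x => hsq hmj (graphFeature G U p x)
    simp only [dotProduct_comm _ (graphFeature G U p y)]
    exact hsq hmi (graphFeature G U p y)
  · congr 1
    -- The frozen means agree, so the comparison applies in both directions and yields equal means
    -- for the pair.
    refine le_antisymm (integral_prod_le_integral_prod_of_forall hb (fun y => ?_)
      fun x => (hmean hmj (graphFeature G U p x)).ge) (integral_prod_le_integral_prod_of_forall hb (fun y => ?_)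
      fun x => (hmean hmj (graphFeature G U p x)).le) <;>
    simp only [dotProduct_comm _ (graphFeature G U p y)]
    exacts [(hmean hmi (graphFeature G U p y)).ge, (hmean hmi (graphFeature G U p y)).le]

-- Source of the threshold for `σ`: each of the finitely many ratios is continuous in `σ` and
-- vanishes at `σ = 0`.
variable (G) in
omit [DecidableEq V] in
theorem eventually_abs_smul_div_le (W : Matrix V V ℝ) (p : ℝ) :
    ∀ᶠ σ : ℝ in 𝓝[>] 0,
      ∀ u v, |((σ ^ 2 / (1 + σ ^ 2)) • W) u v / ((1 - p) / G.degree u)| ≤ 1 / 2 := by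
  refine eventually_all.2 fun u => eventually_all.2 fun v => ?_
  have hc : Continuous fun σ : ℝ =>
      |((σ ^ 2 / (1 + σ ^ 2)) • W) u v / ((1 - p) / G.degree u)| := by
    have h (σ : ℝ) : 1 + σ ^ 2 ≠ 0 := by positivity
    simp only [Matrix.smul_apply, smul_eq_mul]
    fun_prop (disch := exact h _)
  have h := hc.tendsto 0
  refine ((h.mono_left nhdsWithin_le_nhds).eventually_lt_const (u := 1 / 2) ?_).mono
    fun _ => le_of_lt
  norm_num

end Features
end RepellingWalks

theorem theorem1 {V : Type*} [Fintype V] [DecidableEq V]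
    (G : SimpleGraph V) [DecidableRel G.Adj]
    (hG : G.IsTree ∨ RepellingWalks.IsGrid2D G)
    (a : Matrix V V ℝ) (ha : RepellingWalks.IsWeightedAdjacency G a)
    (hW : ∃ c : ℝ, ∀ u v, G.Adj u v → RepellingWalks.normalizedAdj a u v = c)
    (i j : V) (hij : 2 ≤ G.dist i j)
    (p : ℝ) (hp0 : 0 < p) (hp1 : p < 1)
    (m : ℕ) (hm : 0 < m) (hmi : m ≤ G.degree i) (hmj : m ≤ G.degree j) :
    ∀ᶠ σ : ℝ in 𝓝[>] 0,
      let X : (Fin m → List V) × (Fin m → List V) → ℝ :=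
        RepellingWalks.kernelEstimator G (RepellingWalks.normalizedAdj a) p σ
      let μrep := (RepellingWalks.transientRepellingEnsemble G hp0 hp1 m i).prod
        (RepellingWalks.transientRepellingEnsemble G hp0 hp1 m j)
      let μiid := (RepellingWalks.iidEnsemble G hp0 hp1 m i).prod
        (RepellingWalks.iidEnsemble G hp0 hp1 m j)
      MemLp X 2 μrep ∧ MemLp X 2 μiid ∧ variance X μrep ≤ variance X μiid := by
  filter_upwards [RepellingWalks.eventually_abs_smul_div_le G (RepellingWalks.normalizedAdj a) p]
    with σ hU
  have hb (ω : (Fin m → List V) × (Fin m → List V)) :=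
    RepellingWalks.abs_dotProduct_graphFeature_le hU ω.1 ω.2
  have key := RepellingWalks.variance_dotProduct_graphFeature_le hp0 hp1 hU hm hmi hmj
  intro X μrep μiid
  refine ⟨(RepellingWalks.memLp_of_abs_le μrep hb).const_mul _,
    (RepellingWalks.memLp_of_abs_le μiid hb).const_mul _, ?_⟩
  have hX : X = fun ω => ((1 + σ ^ 2) ^ 2)⁻¹ *
      (RepellingWalks.graphFeature G ((σ ^ 2 / (1 + σ ^ 2)) • RepellingWalks.normalizedAdj a) p ω.1
        ⬝ᵥ RepellingWalks.graphFeature G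
          ((σ ^ 2 / (1 + σ ^ 2)) • RepellingWalks.normalizedAdj a) p ω.2) := rfl
  rw [hX, variance_const_mul, variance_const_mul]
  exact mul_le_mul_of_nonneg_left key (sq_nonneg _)
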